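/- Let $\mathcal{L}$ be the language of first-order logic with equality whose only non-logical symbol is a binary relation symbol $\in$, and let $\mathcal{L}_{\mathrm{cl}}$ extend $\mathcal{L}$ by a unary predicate $\mathcal{S}$ (``is a set''). A stratification of an $\mathcal{L}$-formula $\phi$ is a map $\sigma$ from the set of (free and bound) variables of $\phi$ to $\mathbb{N}$ such that $\sigma(y)=\sigma(x)+1$ for every subformula $x\in y$ of $\phi$ and $\sigma(y)=\sigma(x)$ for every subformula $x=y$ of $\phi$. The formula $\phi$ is $2$-stratified if it has a stratification with values in $\{0,1\}$; here formulas are identified when they differ only by renaming of bound variables, so it suffices that some such variant of $\phi$ has one. Let $\mathrm{BAC}$ (adjunctive class theory with Boolean operations) be the $\mathcal{L}_{\mathrm{cl}}$-theory with the following axioms, in which upper case variables range over all objects (classes) and quantifiers over lower case variables are restricted to the objects satisfying $\mathcal{S}$ (sets): - $\forall X\forall Y\,(X\in Y\Rightarrow \mathcal{S}(X))$; - $\forall x\forall X\,(\forall y(y\in X\Rightarrow y\in x)\Rightarrow \mathcal{S}(X))$; - $\exists x\forall y\,(y\notin x)$; - $\forall x\forall y\exists z\forall u\,(u\in z\Leftrightarrow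 (u\in x\lor u=y))$; - $\forall X\forall Y\,(X=Y\Leftrightarrow\forall x(x\in X\Leftrightarrow x\in Y))$; - $\forall x\forall y\exists z\forall u\,(u\in z\Leftrightarrow (u\in x\lor u\in y))$; - $\forall x\exists y\,(y\notin x)$; - $\forall X\forall Y\exists Z\forall x\,(x\in Z\Leftrightarrow (x\in X\lor x\in Y))$; - $\forall X\forall Y\exists Z\forall x\,(x\in Z\Leftrightarrow (x\in X\land x\in Y))$; - $\forall X\exists Y\forall x\,(x\in Y\Leftrightarrow x\notin X)$. Then $\mathrm{BAC}$ decides every $2$-stratified sentence of the pure language of set theory: if $\phi$ is a $2$-stratified $\mathcal{L}$-sentence (regarded as an $\mathcal{L}_{\mathrm{cl}}$-sentence, its quantifiers ranging over all classes), then $$\mathrm{BAC}\vdash\phi\quad\text{or}\quad\mathrm{BAC}\vdash\neg\phi,$$ where $\vdash$ denotes derivability in classical first-order logic with equality. -/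

import Mathlib

namespace BAClass

open FirstOrder FirstOrder.Language

/-! ### Provability in first-order logic with equality -/

section Provability

variable {L : FirstOrder.Language.{0, 0}}

/-- The instance `φ(t)` of a formula `φ(x)` whose distinguished variable `x` is `&0`. -/
def instantiate {α : Type} (φ : L.BoundedFormula α 1) (t : L.Term α) : L.Formula α :=
  φ.toFormula.subst (Sum.elim Term.var fun _ => t)

/-- Classical natural deduction with equality, for formulas with free variables indexed by `α`.
In the rule `allI` the hypotheses are read with one further free variable, which does not occur in
them. A derivation is a finite tree. -/
inductive Derivable : ∀ {α : Type}, Set (L.Formula α) → L.Formula α → Prop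
  | ax {α : Type} {Γ : Set (L.Formula α)} {φ : L.Formula α} :
      φ ∈ Γ → Derivable Γ φ
  | impI {α : Type} {Γ : Set (L.Formula α)} {φ ψ : L.Formula α} :
      Derivable (insert φ Γ) ψ → Derivable Γ (φ.imp ψ)
  | impE {α : Type} {Γ : Set (L.Formula α)} {φ ψ : L.Formula α} :
      Derivable Γ (φ.imp ψ) → Derivable Γ φ → Derivable Γ ψ
  | raa {α : Type} {Γ : Set (L.Formula α)} {φ : L.Formula α} :
      Derivable (insert φ.not Γ) ⊥ → Derivable Γ φ
  | allI {α : Type} {Γ : Set (L.Formula α)} {φ : L.BoundedFormula α 1} :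
      Derivable (Formula.relabel (Sum.inl : α → α ⊕ Fin 1) '' Γ) φ.toFormula →
        Derivable Γ φ.all
  | allE {α : Type} {Γ : Set (L.Formula α)} {φ : L.BoundedFormula α 1} (t : L.Term α) :
      Derivable Γ φ.all → Derivable Γ (instantiate φ t)
  | eqRefl {α : Type} {Γ : Set (L.Formula α)} (t : L.Term α) :
      Derivable Γ (t.equal t)
  | eqSubst {α : Type} {Γ : Set (L.Formula α)} {s t : L.Term α} (φ : L.BoundedFormula α 1) :
      Derivable Γ (s.equal t) → Derivable Γ (instantiate φ s) → Derivable Γ (instantiate φ t)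

/-- `T ⊢ φ` for a theory `T` and a sentence `φ`. Derivations may use countably many free variables,
so that, as usual in first-order logic, domains are taken to be nonempty. -/
def Provable (T : L.Theory) (φ : L.Sentence) : Prop :=
  Derivable (Formula.relabel (Empty.elim : Empty → ℕ) '' T)
    (Formula.relabel (Empty.elim : Empty → ℕ) φ)

end Provability

/-! ### The language of set theory and stratification -/

/-- The only symbol of the language of set theory: binary membership. -/
inductive SetRel : ℕ → Type
  | mem : SetRel 2

/-- The language of set theory. -/
abbrev setLang : FirstOrder.Language.{0, 0} := ⟨fun _ => Empty, SetRel⟩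

/-- As the language of set theory has no function symbols, its terms are variables. -/
def termVar {α : Type} : setLang.Term α → α
  | Term.var a => a
  | Term.func f _ => Empty.elim f

/-- The bound variables of a formula. Formulas are taken up to renaming of bound variables, so there
is one variable for every occurrence of a quantifier; in the case of `all f`, `none` is the variable
bound by the outermost quantifier. -/
def BoundVar {α : Type} : ∀ {n : ℕ}, setLang.BoundedFormula α n → Type
  | _, .falsum => Empty
  | _, .equal _ _ => Empty
  | _, .rel _ _ => Empty
  | _, .imp f g => BoundVar f ⊕ BoundVar g
  | _, .all f => Option (BoundVar f)

/-- `IsStratification φ s σ`: the assignment of types given by `s` on the variables that are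
available from outside and by `σ` on the bound variables of `φ` satisfies `σ(y) = σ(x) + 1` for
every subformula `x ∈ y` and `σ(y) = σ(x)` for every subformula `x = y`. -/
def IsStratification {α : Type} : ∀ {n : ℕ} (φ : setLang.BoundedFormula α n),
    (α ⊕ Fin n → ℕ) → (BoundVar φ → ℕ) → Prop
  | _, .falsum, _, _ => True
  | _, .equal x y, s, _ => s (termVar y) = s (termVar x)
  | _, .rel SetRel.mem xy, s, _ => s (termVar (xy 1)) = s (termVar (xy 0)) + 1
  | _, .imp f g, s, σ =>
      IsStratification f s (fun v => σ (Sum.inl v)) ∧ IsStratification g s (fun v => σ (Sum.inr v))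
  | _, .all f, s, σ =>
      IsStratification f
        (Sum.elim (fun a => s (Sum.inl a))
          (Fin.snoc (α := fun _ => ℕ) (fun i => s (Sum.inr i)) (σ none)))
        (fun v => σ (some v))

/-- A sentence is `k`-stratified if it has a stratification `σ : Var(φ) → {0, …, k - 1}`. -/
def IsStratifiedSentence (k : ℕ) (φ : setLang.Sentence) : Prop :=
  ∃ σ : BoundVar φ → Fin k,
    IsStratification φ (Sum.elim Empty.elim Fin.elim0) (fun v => (σ v : ℕ))

/-! ### The language of class theory and the theory `BAC` -/

/-- The symbols of the language of class theory: binary membership and a unary predicate that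
distinguishes the sets among the classes. -/
inductive ClassRel : ℕ → Type
  | mem : ClassRel 2
  | isSet : ClassRel 1

/-- The single-sorted language of class theory. -/
abbrev classLang : FirstOrder.Language.{0, 0} := ⟨fun _ => Empty, ClassRel⟩

/-- The inclusion of the language of set theory in the language of class theory. -/
def setToClass : setLang →ᴸ classLang where
  onFunction := fun _ f => Empty.elim f
  onRelation := fun _ r => match r with
    | SetRel.mem => ClassRel.mem

section Axioms

variable {n : ℕ}

/-- `x ∈ y`, where `x` and `y` are the variables with de Bruijn levels `i` and `j`. -/
def memF (i j : Fin n) : classLang.BoundedFormula Empty n :=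
  Relations.boundedFormula₂ (L := classLang) ClassRel.mem (Term.var (Sum.inr i))
    (Term.var (Sum.inr j))

/-- `x = y`. -/
def eqF (i j : Fin n) : classLang.BoundedFormula Empty n :=
  Term.bdEqual (Term.var (Sum.inr i)) (Term.var (Sum.inr j))

/-- `x` is a set. -/
def isSetF (i : Fin n) : classLang.BoundedFormula Empty n :=
  Relations.boundedFormula₁ (L := classLang) ClassRel.isSet (Term.var (Sum.inr i))

/-- `∀ x φ` with a lower case variable `x`: for every set `x`. -/
def allSet (φ : classLang.BoundedFormula Empty (n + 1)) : classLang.BoundedFormula Empty n :=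
  ((isSetF (Fin.last n)).imp φ).all

/-- `∃ x φ` with a lower case variable `x`: for some set `x`. -/
def exSet (φ : classLang.BoundedFormula Empty (n + 1)) : classLang.BoundedFormula Empty n :=
  (isSetF (Fin.last n) ⊓ φ).ex

end Axioms

/- In the axioms below the variables are numbered from the outermost quantifier inwards. -/

/-- `∀ X ∀ Y (X ∈ Y → ∃ x (x = X))`, where `∃ x (x = X)` abbreviates that `X` is a set. -/
def axMem : classLang.Sentence :=
  ((memF (n := 2) 0 1).imp (isSetF 0)).all.all

/-- `∀ x ∀ X (∀ y (y ∈ X → y ∈ x) → ∃ z (z = X))`. -/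
def axSubset : classLang.Sentence :=
  allSet (BoundedFormula.all ((allSet ((memF (n := 3) 2 1).imp (memF 2 0))).imp (isSetF 1)))

/-- `∃ x ∀ y (y ∉ x)`. -/
def axEmp : classLang.Sentence :=
  exSet (allSet (memF (n := 2) 1 0).not)

/-- `∀ x ∀ y ∃ z ∀ u (u ∈ z ↔ u ∈ x ∨ u = y)`. -/
def axAdj : classLang.Sentence :=
  allSet (allSet (exSet (allSet ((memF (n := 4) 3 2).iff (memF 3 0 ⊔ eqF 3 1)))))

/-- `∀ X ∀ Y (X = Y ↔ ∀ x (x ∈ X ↔ x ∈ Y))`. -/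
def axCExt : classLang.Sentence :=
  ((eqF (n := 2) 0 1).iff (allSet ((memF (n := 3) 2 0).iff (memF 2 1)))).all.all

/-- `∀ x ∀ y ∃ z ∀ u (u ∈ z ↔ u ∈ x ∨ u ∈ y)`. -/
def axUnion : classLang.Sentence :=
  allSet (allSet (exSet (allSet ((memF (n := 4) 3 2).iff (memF 3 0 ⊔ memF 3 1)))))

/-- `∀ x ∃ y (y ∉ x)`. -/
def axUB : classLang.Sentence :=
  allSet (exSet (memF (n := 2) 1 0).not)

/-- `∀ X ∀ Y ∃ Z ∀ x (x ∈ Z ↔ x ∈ X ∨ x ∈ Y)`. -/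
def axCUnion : classLang.Sentence :=
  (allSet ((memF (n := 4) 3 2).iff (memF 3 0 ⊔ memF 3 1))).ex.all.all

/-- `∀ X ∀ Y ∃ Z ∀ x (x ∈ Z ↔ x ∈ X ∧ x ∈ Y)`. -/
def axCIntersection : classLang.Sentence :=
  (allSet ((memF (n := 4) 3 2).iff (memF 3 0 ⊓ memF 3 1))).ex.all.all

/-- `∀ X ∃ Y ∀ x (x ∈ Y ↔ x ∉ X)`. -/
def axCComp : classLang.Sentence :=
  (allSet ((memF (n := 3) 2 1).iff (memF 2 0).not)).ex.all

/-- Adjunctive Set Theory with Classes. -/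
def CAS : classLang.Theory := {axMem, axSubset, axEmp, axAdj}

/-- Adjunctive Class Theory with Boolean operations. -/
def BAC : classLang.Theory :=
  CAS ∪ {axCExt, axUnion, axUB, axCUnion, axCIntersection, axCComp}

end BAClass

/-! By completeness of the calculus it suffices that any two models of `BAC` agree on φ: if some
model satisfies φ then all do and φ is provable; otherwise every model refutes φ and its negation is
provable. Completeness (`provable_of_forall_models`) is Henkin's construction, with the variables
themselves as witnesses.

Agreement is an Ehrenfeucht–Fraïssé argument (`exists_forall_similar_realize_iff`). In a
2-stratified formula an object of type 1 matters through its extension, a subset of the domain of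
sets, and an object of type 0 through the singleton of itself, which is empty if it is a proper
class. The extensions form a field of sets containing all finite sets, so a position of the game is
a finite family in such a field. What matters about it is the size of each cell of the generated
partition, counted only up to a bound K. If two positions agree up to 2K, any new set on one side
can be answered so that they agree up to K (`SameCells.exists_extension`); each quantifier thus
doubles the bound required.

Proper classes in type 0 positions have no elementhood and are told apart only by equality, so
answering them needs an unlimited supply (`infinite_setOf_not_isSet`). The game starts with one
cell, the whole domain, which is infinite in every model. -/

namespace BAClass

open FirstOrder FirstOrder.Language Set Filter

variable {L : FirstOrder.Language.{0, 0}} {α β γ : Type} {n m k : ℕ}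

/-! ### Renaming the variables of a formula -/

/-- The extension of a renaming of variables to the scope of a further quantifier. -/
def liftVar (s : α ⊕ Fin n → β ⊕ Fin m) : α ⊕ Fin (n + 1) → β ⊕ Fin (m + 1) :=
  Sum.elim (fun a => Sum.map id Fin.castSucc (s (Sum.inl a)))
    (Fin.snoc (α := fun _ => β ⊕ Fin (m + 1))
      (fun i => Sum.map id Fin.castSucc (s (Sum.inr i))) (Sum.inr (Fin.last m)))

/-- Simultaneous renaming of all variables in scope, which may bind free variables or free
bound ones. -/
def rename : ∀ {n m : ℕ}, (α ⊕ Fin n → β ⊕ Fin m) → L.BoundedFormula α n → L.BoundedFormula β m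
  | _, _, _, .falsum => .falsum
  | _, _, s, .equal t u => .equal (t.relabel s) (u.relabel s)
  | _, _, s, .rel R ts => .rel R fun i => (ts i).relabel s
  | _, _, s, .imp φ ψ => .imp (rename s φ) (rename s ψ)
  | _, _, s, .all φ => .all (rename (liftVar s) φ)

theorem liftVar_comp (t : β ⊕ Fin m → γ ⊕ Fin k) (s : α ⊕ Fin n → β ⊕ Fin m) :
    liftVar t ∘ liftVar s = liftVar (t ∘ s) := by
  have key : ∀ x : β ⊕ Fin m,
      liftVar t (Sum.map id Fin.castSucc x) = Sum.map id Fin.castSucc (t x) := by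
    rintro (b | j) <;> simp [liftVar]
  funext x
  rcases x with a | i
  · simpa [liftVar] using key (s (Sum.inl a))
  · refine Fin.lastCases ?_ (fun i => ?_) i
    · simp [liftVar]
    · simpa [liftVar] using key (s (Sum.inr i))

theorem liftVar_map (f : α → β) : liftVar (Sum.map f id : α ⊕ Fin n → β ⊕ Fin n) = Sum.map f id := by
  funext x
  rcases x with a | i
  · simp [liftVar]
  · refine Fin.lastCases ?_ (fun i => ?_) i <;> simp [liftVar]

theorem rename_rename (φ : L.BoundedFormula α n) (s : α ⊕ Fin n → β ⊕ Fin m)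
    (t : β ⊕ Fin m → γ ⊕ Fin k) : rename t (rename s φ) = rename (t ∘ s) φ := by
  induction φ generalizing m k with
  | falsum => rfl
  | equal => simp [rename]
  | rel => simp [rename]
  | imp _ _ ih₁ ih₂ => simp [rename, ih₁, ih₂]
  | all _ ih => simp [rename, ih, liftVar_comp]

theorem rename_id (φ : L.BoundedFormula α n) : rename id φ = φ := by
  induction φ with
  | falsum => rfl
  | equal => simp [rename]
  | rel => simp [rename]
  | imp _ _ ih₁ ih₂ => simp [rename, ih₁, ih₂]
  | @all n _ ih =>
    have h := liftVar_map (n := n) (id : α → α)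
    rw [Sum.map_id_id, Sum.map_id_id] at h
    simp [rename, h, ih]

/-- This and the next lemmas reduce `relabel`, substitution of variables and `toFormula` to
`rename`, so that identities between formulas become identities between maps of variables. -/
theorem relabel_eq_rename (g : α → β ⊕ Fin n) (φ : L.BoundedFormula α k) :
    φ.relabel g = rename (BoundedFormula.relabelAux g k) φ := by
  induction φ with
  | falsum => rfl
  | equal => rfl
  | rel => rfl
  | imp _ _ ih₁ ih₂ => simp [rename, ih₁, ih₂]
  | @all k φ ih =>
    rw [BoundedFormula.relabel_all, ih]
    have h : liftVar (BoundedFormula.relabelAux g k) = BoundedFormula.relabelAux g (k + 1) := by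
      funext x
      rcases x with a | i
      · simp only [liftVar, BoundedFormula.relabelAux, Sum.elim_inl, Function.comp_apply,
          Sum.map_inl]
        rcases g a with b | j
        · simp
        · simp; rfl
      · refine Fin.lastCases ?_ (fun i => ?_) i
        · simp [liftVar, BoundedFormula.relabelAux]
        · simp [liftVar, BoundedFormula.relabelAux]
    rw [rename, h]

theorem formula_relabel_eq_rename (g : α → β) (φ : L.Formula α) :
    Formula.relabel g φ = rename (Sum.map g id) φ := by
  unfold Formula.relabel
  rw [relabel_eq_rename]
  congr 1
  funext x
  rcases x with a | i
  · simp [BoundedFormula.relabelAux]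
  · exact i.elim0

theorem subst_eq_rename (f : α → β) (φ : L.BoundedFormula α n) :
    φ.subst (fun a => Term.var (f a)) = rename (Sum.map f id) φ := by
  have key : ∀ {n : ℕ} (t : L.Term (α ⊕ Fin n)),
      t.subst (Sum.elim (Term.relabel Sum.inl ∘ fun a => Term.var (f a)) (Term.var ∘ Sum.inr)) =
        t.relabel (Sum.map f id) := by
    intro n t
    induction t with
    | var x => rcases x with a | i <;> simp
    | func F ts ih => simp [ih]
  unfold BoundedFormula.subst
  induction φ with
  | falsum => rfl
  | equal => simp [BoundedFormula.mapTermRel, rename, key]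
  | rel => simp [BoundedFormula.mapTermRel, rename, key]
  | imp _ _ ih₁ ih₂ => simp [BoundedFormula.mapTermRel, rename, ih₁, ih₂]
  | all _ ih => simp [BoundedFormula.mapTermRel, rename, ih, liftVar_map]

theorem toFormula_eq_rename (φ : L.BoundedFormula α n) : φ.toFormula = rename Sum.inl φ := by
  induction φ with
  | falsum => rfl
  | equal t u => simp [rename, Term.equal, Term.bdEqual]
  | rel R ts => rfl
  | imp _ _ ih₁ ih₂ => simp [rename, ih₁, ih₂]
  | @all n φ ih =>
    rw [BoundedFormula.toFormula, ih, relabel_eq_rename, rename_rename, rename]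
    congr 2
    funext x
    rcases x with a | i
    · simp [liftVar, BoundedFormula.relabelAux]
    · refine Fin.lastCases ?_ (fun i => ?_) i
      · simp only [liftVar, BoundedFormula.relabelAux, Function.comp_apply, Sum.map_inl,
          Sum.elim_inr, Fin.snoc_last, finSumFinEquiv_symm_last]
        simp
        rfl
      · simp [liftVar, BoundedFormula.relabelAux]

theorem instantiate_var (φ : L.BoundedFormula α 1) (b : α) :
    instantiate φ (Term.var b) = rename (Sum.elim Sum.inl fun _ => Sum.inl b) φ := by
  have h : (Sum.elim Term.var fun _ => Term.var b : α ⊕ Fin 1 → L.Term α) =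
      fun x => Term.var (Sum.elim id (fun _ => b) x) := by
    funext x
    rcases x with a | i <;> rfl
  rw [instantiate, h, subst_eq_rename, toFormula_eq_rename, rename_rename]
  congr 1
  funext x
  rcases x with a | i <;> rfl

/-! ### Structural properties of derivability -/

namespace Derivable

theorem mono {Γ Δ : Set (L.Formula α)} {φ : L.Formula α} (h : Derivable Γ φ) (hΓ : Γ ⊆ Δ) :
    Derivable Δ φ := by
  induction h with
  | ax h => exact .ax (hΓ h)
  | impI _ ih => exact .impI (ih (insert_subset_insert hΓ))
  | impE _ _ ih₁ ih₂ => exact .impE (ih₁ hΓ) (ih₂ hΓ)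
  | raa _ ih => exact .raa (ih (insert_subset_insert hΓ))
  | allI _ ih => exact .allI (ih (image_mono hΓ))
  | allE t _ ih => exact .allE t (ih hΓ)
  | eqRefl t => exact .eqRefl t
  | eqSubst φ _ _ ih₁ ih₂ => exact .eqSubst φ (ih₁ hΓ) (ih₂ hΓ)

theorem exists_finite {Γ : Set (L.Formula α)} {φ : L.Formula α} (h : Derivable Γ φ) :
    ∃ Δ ⊆ Γ, Δ.Finite ∧ Derivable Δ φ := by
  have insert_case : ∀ {α : Type} {Γ : Set (L.Formula α)} {φ ψ : L.Formula α},
      (∃ Δ ⊆ insert φ Γ, Δ.Finite ∧ Derivable Δ ψ) →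
        ∃ Δ ⊆ Γ, Δ.Finite ∧ Derivable (insert φ Δ) ψ := by
    rintro α Γ φ ψ ⟨Δ, hΔ, hf, hd⟩
    refine ⟨Δ \ {φ}, ?_, hf.sdiff, hd.mono ?_⟩
    · rintro x ⟨hx, hx'⟩
      exact (hΔ hx).resolve_left hx'
    · intro x hx
      by_cases h : x = φ
      · exact .inl h
      · exact .inr ⟨hx, h⟩
  induction h with
  | @ax α Γ φ h => exact ⟨{φ}, by simpa using h, finite_singleton _, .ax rfl⟩
  | impI _ ih =>
    obtain ⟨Δ, hΔ, hf, hd⟩ := insert_case ih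
    exact ⟨Δ, hΔ, hf, .impI hd⟩
  | impE _ _ ih₁ ih₂ =>
    obtain ⟨Δ₁, hΔ₁, hf₁, hd₁⟩ := ih₁
    obtain ⟨Δ₂, hΔ₂, hf₂, hd₂⟩ := ih₂
    exact ⟨Δ₁ ∪ Δ₂, union_subset hΔ₁ hΔ₂, hf₁.union hf₂,
      .impE (hd₁.mono subset_union_left) (hd₂.mono subset_union_right)⟩
  | raa _ ih =>
    obtain ⟨Δ, hΔ, hf, hd⟩ := insert_case ih
    exact ⟨Δ, hΔ, hf, .raa hd⟩
  | allI _ ih =>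
    obtain ⟨Δ, hΔ, hf, hd⟩ := exists_subset_image_finite_and.1 ih
    exact ⟨Δ, hΔ, hf, .allI hd⟩
  | allE t _ ih =>
    obtain ⟨Δ, hΔ, hf, hd⟩ := ih
    exact ⟨Δ, hΔ, hf, .allE t hd⟩
  | eqRefl t => exact ⟨∅, empty_subset _, finite_empty, .eqRefl t⟩
  | eqSubst φ _ _ ih₁ ih₂ =>
    obtain ⟨Δ₁, hΔ₁, hf₁, hd₁⟩ := ih₁
    obtain ⟨Δ₂, hΔ₂, hf₂, hd₂⟩ := ih₂
    exact ⟨Δ₁ ∪ Δ₂, union_subset hΔ₁ hΔ₂, hf₁.union hf₂,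
      .eqSubst φ (hd₁.mono subset_union_left) (hd₂.mono subset_union_right)⟩

end Derivable

theorem term_eq_var [L.IsRelational] (t : L.Term α) : ∃ a, t = Term.var a := by
  cases t with
  | var a => exact ⟨a, rfl⟩
  | func f _ => exact isEmptyElim f

theorem rename_instantiate [L.IsRelational] (f : α → β) (φ : L.BoundedFormula α 1) (t : L.Term α) :
    Formula.relabel f (instantiate φ t) =
      instantiate (rename (Sum.map f id) φ) (t.relabel f) := by
  obtain ⟨a, rfl⟩ := term_eq_var t
  rw [Term.relabel, instantiate_var, instantiate_var, formula_relabel_eq_rename, rename_rename,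
    rename_rename]
  congr 1
  funext x
  rcases x with a | i <;> rfl

/-- The renaming need not be injective: the eigenvariable of `allI` lives in a separate summand,
which `Sum.map f id` leaves alone, so it can never clash. -/
theorem Derivable.relabel [L.IsRelational] {Γ : Set (L.Formula α)} {φ : L.Formula α}
    (h : Derivable Γ φ) (f : α → β) :
    Derivable (Formula.relabel f '' Γ) (Formula.relabel f φ) := by
  induction h generalizing β with
  | ax h => exact .ax (mem_image_of_mem _ h)
  | impI _ ih =>
    have := ih f
    rw [image_insert_eq] at this
    exact .impI this
  | impE _ _ ih₁ ih₂ => exact .impE (ih₁ f) (ih₂ f)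
  | raa _ ih =>
    have := ih f
    rw [image_insert_eq] at this
    exact .raa this
  | @allI α Γ φ _ ih =>
    have e : Formula.relabel f φ.all = (rename (Sum.map f id) φ).all := by
      rw [formula_relabel_eq_rename, rename, liftVar_map]
    rw [e]
    refine .allI ?_
    convert ih (Sum.map f (id : Fin 1 → Fin 1)) using 1
    · rw [image_image, image_image]
      refine image_congr fun ψ _ => ?_
      simp only [formula_relabel_eq_rename, rename_rename]
      congr 1
      funext x
      rcases x with a | i <;> rfl
    · simp only [formula_relabel_eq_rename, rename_rename, toFormula_eq_rename]
      congr 1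
  | allE t _ ih =>
    rw [rename_instantiate]
    refine .allE _ ?_
    have := ih f
    rwa [formula_relabel_eq_rename, rename, liftVar_map] at this
  | eqRefl t =>
    obtain ⟨a, rfl⟩ := term_eq_var t
    exact .eqRefl (Term.var (f a))
  | @eqSubst α Γ s t φ _ _ ih₁ ih₂ =>
    rw [rename_instantiate]
    refine .eqSubst (s := s.relabel f) _ ?_ ?_
    · obtain ⟨a, rfl⟩ := term_eq_var s
      obtain ⟨b, rfl⟩ := term_eq_var t
      exact ih₁ f
    · rw [← rename_instantiate]
      exact ih₂ f

/-! ### Fresh variables -/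

/-- The variable `c` does not occur free in `φ`: replacing it by any other variable has no
effect. -/
def IsFresh (c : ℕ) (φ : L.BoundedFormula ℕ n) : Prop :=
  ∀ d, rename (Sum.map (Function.update id c d) id) φ = φ

theorem eventually_isFresh [L.IsRelational] (φ : L.BoundedFormula ℕ n) :
    ∀ᶠ c in atTop, IsFresh c φ := by
  have key : ∀ {n : ℕ} (t : L.Term (ℕ ⊕ Fin n)),
      ∀ᶠ c in atTop, ∀ d, t.relabel (Sum.map (Function.update id c d) id) = t := by
    intro n t
    obtain ⟨x, rfl⟩ := term_eq_var t
    rcases x with a | i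
    · filter_upwards [eventually_gt_atTop a] with c hc d
      simp [Function.update_of_ne hc.ne]
    · simp
  induction φ with
  | falsum => exact .of_forall fun c d => rfl
  | equal t u =>
    filter_upwards [key t, key u] with c ht hu d
    rw [rename, ht, hu]
  | rel R ts =>
    filter_upwards [eventually_all.2 fun i => key (ts i)] with c h d
    simp only [rename, h]
  | imp _ _ ih₁ ih₂ =>
    filter_upwards [ih₁, ih₂] with c h₁ h₂ d
    rw [rename, h₁, h₂]
  | all _ ih =>
    filter_upwards [ih] with c h d
    rw [rename, liftVar_map, h]

theorem IsFresh.rename_eq {c : ℕ} {φ : L.BoundedFormula ℕ n} (h : IsFresh c φ)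
    {s t : ℕ ⊕ Fin n → β ⊕ Fin m} (hst : ∀ x, x ≠ Sum.inl c → s x = t x) :
    rename s φ = rename t φ := by
  -- Any variable other than `c` would do: after `c` has been replaced, the value of the renaming at
  -- `c` is never consulted.
  rw [← h (c + 1), rename_rename, rename_rename]
  congr 1
  funext x
  refine hst _ ?_
  rcases x with a | i
  · by_cases ha : a = c
    · simp [ha]
    · simpa [Function.update_of_ne ha] using ha
  · simp

/-- Generalization over a named variable: sending `c` to the extra variable of `allI` changes
neither Γ nor φ, by freshness. -/
theorem Derivable.all_of_isFresh [L.IsRelational] {Γ : Set (L.Formula ℕ)}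
    {φ : L.BoundedFormula ℕ 1} {c : ℕ} (hΓ : ∀ ψ ∈ Γ, IsFresh c ψ) (hφ : IsFresh c φ)
    (h : Derivable Γ (instantiate φ (Term.var c))) : Derivable Γ φ.all := by
  refine .allI ?_
  let r : ℕ → ℕ ⊕ Fin 1 := Function.update Sum.inl c (Sum.inr 0)
  have hr : ∀ a, a ≠ c → r a = Sum.inl a := fun a ha => Function.update_of_ne ha _ _
  have hc : r c = Sum.inr 0 := Function.update_self _ _ _
  convert h.relabel r using 1
  · refine image_congr fun ψ hψ => ?_
    rw [formula_relabel_eq_rename, formula_relabel_eq_rename]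
    refine (hΓ ψ hψ).rename_eq fun x hx => ?_
    rcases x with a | i
    · simp [hr a (by simpa using hx)]
    · rfl
  · rw [toFormula_eq_rename, instantiate_var, formula_relabel_eq_rename, rename_rename]
    refine hφ.rename_eq fun x hx => ?_
    rcases x with a | i
    · simp [hr a (by simpa using hx)]
    · simp [hc, Fin.fin_one_eq_zero i]

/-! ### Consistent sets of formulas -/

/-- No contradiction is derivable. -/
def Consistent (Γ : Set (L.Formula α)) : Prop := ¬ Derivable Γ ⊥

namespace Derivable

variable {Γ : Set (L.Formula α)} {φ ψ : L.Formula α}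

theorem exfalso (h : Derivable Γ ⊥) : Derivable Γ φ :=
  .raa (h.mono (subset_insert _ _))

theorem imp_of_right (h : Derivable Γ ψ) : Derivable Γ (φ.imp ψ) :=
  .impI (h.mono (subset_insert _ _))

theorem imp_of_not (h : Derivable Γ φ.not) : Derivable Γ (φ.imp ψ) :=
  .impI (.exfalso (.impE (h.mono (subset_insert _ _)) (.ax (mem_insert _ _))))

theorem left_of_not_imp (h : Derivable Γ (φ.imp ψ).not) : Derivable Γ φ :=
  .raa (.impE (h.mono (subset_insert _ _)) (.imp_of_not (.ax (mem_insert _ _))))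

theorem not_right_of_not_imp (h : Derivable Γ (φ.imp ψ).not) : Derivable Γ ψ.not :=
  .impI (.impE (h.mono (subset_insert _ _)) (.imp_of_right (.ax (mem_insert _ _))))

end Derivable

theorem consistent_sUnion_of_directedOn {c : Set (Set (L.Formula α))} (hne : c.Nonempty)
    (hd : DirectedOn (· ⊆ ·) c) (hc : ∀ Γ ∈ c, Consistent Γ) : Consistent (⋃₀ c) := by
  intro h
  obtain ⟨Δ, hΔ, hf, hder⟩ := h.exists_finite
  obtain ⟨Γ, hΓ, hsub⟩ := hd.exists_mem_subset_of_finite_of_subset_sUnion hne hf hΔ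
  exact hc Γ hΓ (hder.mono hsub)

/-- Every instance of a universal formula that fails has a witness among the variables. -/
def HasWitnesses (Γ : Set (L.Formula ℕ)) : Prop :=
  ∀ φ : L.BoundedFormula ℕ 1, ∃ c : ℕ, (instantiate φ (Term.var c)).imp φ.all ∈ Γ

/-- If adding φ(c) → ∀φ for fresh `c` were inconsistent, Γ would derive both φ(c) and ¬∀φ, yet φ(c)
generalizes to ∀φ. One new formula uses finitely many variables, so almost all stay fresh and the
step can be iterated. -/
theorem exists_witness_extension [L.IsRelational] {Γ : Set (L.Formula ℕ)} (hΓ : Consistent Γ)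
    (hfresh : ∀ᶠ c in atTop, ∀ ψ ∈ Γ, IsFresh c ψ) (φ : L.BoundedFormula ℕ 1) :
    ∃ Δ, Γ ⊆ Δ ∧ Consistent Δ ∧ (∀ᶠ c in atTop, ∀ ψ ∈ Δ, IsFresh c ψ) ∧
      ∃ c : ℕ, (instantiate φ (Term.var c)).imp φ.all ∈ Δ := by
  obtain ⟨c, hc, hφ⟩ := (hfresh.and (eventually_isFresh φ)).exists
  refine ⟨insert ((instantiate φ (Term.var c)).imp φ.all) Γ, subset_insert _ _, fun h => ?_, ?_,
    c, mem_insert _ _⟩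
  · have hn : Derivable Γ ((instantiate φ (Term.var c)).imp φ.all).not := .impI h
    exact hΓ (.impE hn.not_right_of_not_imp (.all_of_isFresh hc hφ hn.left_of_not_imp))
  · filter_upwards [hfresh,
      eventually_isFresh ((instantiate φ (Term.var c)).imp φ.all)] with d h₁ h₂
    rintro ψ (rfl | hψ)
    exacts [h₂, h₁ ψ hψ]

theorem exists_hasWitnesses_extension [L.IsRelational] [Countable (L.BoundedFormula ℕ 1)]
    {Γ : Set (L.Formula ℕ)} (hΓ : Consistent Γ)
    (hfresh : ∀ᶠ c in atTop, ∀ ψ ∈ Γ, IsFresh c ψ) :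
    ∃ Δ, Γ ⊆ Δ ∧ Consistent Δ ∧ HasWitnesses Δ := by
  have : Nonempty (L.BoundedFormula ℕ 1) := ⟨.falsum⟩
  obtain ⟨e, he⟩ := exists_surjective_nat (L.BoundedFormula ℕ 1)
  let S := {Γ : Set (L.Formula ℕ) // Consistent Γ ∧ ∀ᶠ c in atTop, ∀ ψ ∈ Γ, IsFresh c ψ}
  have step : ∀ (Γ : S) (φ : L.BoundedFormula ℕ 1), ∃ Δ : S, Γ.1 ⊆ Δ.1 ∧
      ∃ c : ℕ, (instantiate φ (Term.var c)).imp φ.all ∈ Δ.1 := fun Γ φ =>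
    let ⟨Δ, h₁, h₂, h₃, h₄⟩ := exists_witness_extension Γ.2.1 Γ.2.2 φ
    ⟨⟨Δ, h₂, h₃⟩, h₁, h₄⟩
  choose F hF hw using step
  let seq : ℕ → S := fun k => Nat.rec ⟨Γ, hΓ, hfresh⟩ (fun k Γ => F Γ (e k)) k
  have hmono : Monotone fun k => (seq k).1 := monotone_nat_of_le_succ fun k => hF (seq k) (e k)
  refine ⟨⋃₀ range fun k => (seq k).1, subset_sUnion_of_mem ⟨0, rfl⟩, ?_, fun φ => ?_⟩
  · refine consistent_sUnion_of_directedOn (range_nonempty _)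
      (directedOn_range.2 hmono.directed_le) ?_
    rintro _ ⟨k, rfl⟩
    exact (seq k).2.1
  · obtain ⟨k, rfl⟩ := he φ
    obtain ⟨c, hc⟩ := hw (seq k) (e k)
    exact ⟨c, mem_sUnion_of_mem hc ⟨k + 1, rfl⟩⟩

/-- A consistent, complete and deductively closed set of formulas with witnesses. -/
structure IsHenkin (H : Set (L.Formula ℕ)) : Prop where
  mem_of_derivable {φ : L.Formula ℕ} : Derivable H φ → φ ∈ H
  consistent : Consistent H
  mem_or_not_mem (φ : L.Formula ℕ) : φ ∈ H ∨ φ.not ∈ H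
  hasWitnesses : HasWitnesses H

theorem exists_isHenkin [L.IsRelational] [Countable (L.BoundedFormula ℕ 1)]
    {Γ : Set (L.Formula ℕ)} (hΓ : Consistent Γ)
    (hfresh : ∀ᶠ c in atTop, ∀ ψ ∈ Γ, IsFresh c ψ) : ∃ H, Γ ⊆ H ∧ IsHenkin H := by
  obtain ⟨Δ, hΓΔ, hΔ, hw⟩ := exists_hasWitnesses_extension hΓ hfresh
  obtain ⟨H, hΔH, hH⟩ := zorn_subset_nonempty {H : Set (L.Formula ℕ) | Consistent H}
    (fun c hc hch hne => ⟨⋃₀ c, consistent_sUnion_of_directedOn hne hch.directedOn hc,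
      fun _ => subset_sUnion_of_mem⟩) Δ hΔ
  have mem_of_consistent : ∀ φ, Consistent (insert φ H) → φ ∈ H := fun φ h =>
    hH.2 h (subset_insert _ _) (mem_insert _ _)
  have mem_of_derivable : ∀ φ, Derivable H φ → φ ∈ H := fun φ h =>
    mem_of_consistent φ fun h' => hH.1 (.impE (.impI h') h)
  refine ⟨H, hΓΔ.trans hΔH, ?_, hH.1, fun φ => ?_, fun φ => (hw φ).imp fun c hc => hΔH hc⟩
  · exact fun h => mem_of_derivable _ h
  · by_cases h : Consistent (insert φ H)
    · exact .inl (mem_of_consistent φ h)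
    · exact .inr (mem_of_derivable _ (.impI (not_not.1 h)))

/-! ### The term model -/

namespace IsHenkin

variable {H : Set (L.Formula ℕ)}

theorem imp_mem_iff (hH : IsHenkin H) {φ ψ : L.Formula ℕ} :
    φ.imp ψ ∈ H ↔ (φ ∈ H → ψ ∈ H) := by
  refine ⟨fun h hφ => hH.mem_of_derivable (.impE (.ax h) (.ax hφ)), fun h => ?_⟩
  rcases hH.mem_or_not_mem φ with hφ | hφ
  · exact hH.mem_of_derivable (.imp_of_right (.ax (h hφ)))
  · exact hH.mem_of_derivable (.imp_of_not (.ax hφ))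

theorem falsum_notMem (hH : IsHenkin H) : (⊥ : L.Formula ℕ) ∉ H :=
  fun h => hH.consistent (.ax h)

theorem all_mem_iff [L.IsRelational] (hH : IsHenkin H) {φ : L.BoundedFormula ℕ 1} :
    φ.all ∈ H ↔ ∀ c : ℕ, instantiate φ (Term.var c) ∈ H := by
  refine ⟨fun h c => hH.mem_of_derivable (.allE _ (.ax h)), fun h => ?_⟩
  obtain ⟨c, hc⟩ := hH.hasWitnesses φ
  exact hH.imp_mem_iff.1 hc (h c)

theorem eq_refl_mem (hH : IsHenkin H) (a : ℕ) :
    ((Term.var a).equal (Term.var a) : L.Formula ℕ) ∈ H :=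
  hH.mem_of_derivable (.eqRefl _)

theorem rename_mem_of_eq_mem [L.IsRelational] (hH : IsHenkin H) {n : ℕ} (ψ : L.Formula (Fin n))
    {v w : Fin n → ℕ} (h : ∀ i, ((Term.var (v i)).equal (Term.var (w i)) : L.Formula ℕ) ∈ H)
    (hv : rename (Sum.map v id) ψ ∈ H) : rename (Sum.map w id) ψ ∈ H := by
  -- The variables are exchanged one at a time, `s` being the set of places already changed, because
  -- `eqSubst` replaces a single variable.
  have key : ∀ s : Finset (Fin n),
      rename (Sum.map (fun i => if i ∈ s then w i else v i) id) ψ ∈ H := by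
    intro s
    induction s using Finset.induction_on with
    | empty => simpa using hv
    | insert j s hj ih =>
      let u : Fin n → ℕ := fun i => if i ∈ s then w i else v i
      let φ : L.BoundedFormula ℕ 1 :=
        rename (Sum.elim (Function.update (fun i => Sum.inl (u i)) j (Sum.inr 0)) Fin.elim0) ψ
      have hφ : ∀ b, instantiate φ (Term.var b) = rename (Sum.map (Function.update u j b) id) ψ := by
        intro b
        rw [instantiate_var, rename_rename]
        congr 1
        funext x
        rcases x with i | i
        · by_cases hi : i = j
          · simp only [hi, Function.comp_apply, Sum.elim_inl, Sum.map_inl, Function.update_self,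
              Sum.elim_inr]
          · simp only [Function.comp_apply, Sum.elim_inl, Sum.map_inl, Function.update_of_ne hi]
        · exact i.elim0
      have h₁ : instantiate φ (Term.var (v j)) ∈ H := by
        rw [hφ, Function.update_eq_self_iff.2 (by simp [u, hj])]
        exact ih
      have h₂ : instantiate φ (Term.var (w j)) ∈ H :=
        hH.mem_of_derivable (.eqSubst φ (.ax (h j)) (.ax h₁))
      rw [hφ] at h₂
      convert h₂ using 3
      funext i
      by_cases hi : i = j
      · simp [hi]
      · simp [hi, u]
  simpa using key Finset.univ

theorem eq_mem_of_eq_mem [L.IsRelational] (hH : IsHenkin H) {a b c d : ℕ}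
    (hac : ((Term.var a).equal (Term.var c) : L.Formula ℕ) ∈ H)
    (hbd : ((Term.var b).equal (Term.var d) : L.Formula ℕ) ∈ H)
    (hab : ((Term.var a).equal (Term.var b) : L.Formula ℕ) ∈ H) :
    ((Term.var c).equal (Term.var d) : L.Formula ℕ) ∈ H := by
  have h := hH.rename_mem_of_eq_mem (((Term.var 0).equal (Term.var 1) : L.Formula (Fin 2)))
    (v := ![a, b]) (w := ![c, d]) (Fin.forall_fin_two.2 ⟨hac, hbd⟩)
  exact h hab

/-- Provable equality of variables. -/
def setoid [L.IsRelational] (hH : IsHenkin H) : Setoid ℕ where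
  r a b := ((Term.var a).equal (Term.var b) : L.Formula ℕ) ∈ H
  iseqv :=
    ⟨hH.eq_refl_mem, fun {a _} h => hH.eq_mem_of_eq_mem h (hH.eq_refl_mem a) (hH.eq_refl_mem a),
      fun {a _ _} h h' => hH.eq_mem_of_eq_mem (hH.eq_refl_mem a) h' h⟩

theorem rename_mem_iff_of_eq_mem [L.IsRelational] (hH : IsHenkin H) {n : ℕ} (ψ : L.Formula (Fin n))
    {v w : Fin n → ℕ} (h : ∀ i, ((Term.var (v i)).equal (Term.var (w i)) : L.Formula ℕ) ∈ H) :
    rename (Sum.map v id) ψ ∈ H ↔ rename (Sum.map w id) ψ ∈ H :=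
  ⟨hH.rename_mem_of_eq_mem ψ h,
    hH.rename_mem_of_eq_mem ψ fun i => hH.setoid.iseqv.symm (h i)⟩

/-- The term model of a Henkin set: the variables modulo provable equality. -/
def Model [L.IsRelational] (hH : IsHenkin H) : Type := Quotient hH.setoid

variable [L.IsRelational] (hH : IsHenkin H)

/-- The element of the term model named by a variable. -/
def toModel (a : ℕ) : hH.Model := Quotient.mk hH.setoid a

theorem toModel_eq_iff {a b : ℕ} :
    hH.toModel a = hH.toModel b ↔ ((Term.var a).equal (Term.var b) : L.Formula ℕ) ∈ H :=
  Quotient.eq (r := hH.setoid)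

theorem toModel_surjective : Function.Surjective hH.toModel :=
  Quotient.mk_surjective

instance : Nonempty hH.Model := ⟨hH.toModel 0⟩

/-- Relations are read off at chosen representatives; by `rename_mem_iff_of_eq_mem` the choice is
immaterial. -/
noncomputable instance : L.Structure hH.Model where
  funMap f := isEmptyElim f
  RelMap R xs :=
    R.formula (fun i => Term.var (Function.surjInv hH.toModel_surjective (xs i))) ∈ H

/-- The truth lemma. Naming the values of the bound variables by `v` lets the induction pass under a
quantifier, where `all_mem_iff` supplies the witnesses. -/
theorem mem_iff_realize (φ : L.BoundedFormula ℕ n) (v : Fin n → ℕ) :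
    rename (Sum.elim Sum.inl fun i => Sum.inl (v i)) φ ∈ H ↔
      φ.Realize hH.toModel fun i => hH.toModel (v i) := by
  have key : ∀ {n : ℕ} (v : Fin n → ℕ) (t : L.Term (ℕ ⊕ Fin n)), ∃ a : ℕ,
      t.relabel (Sum.elim Sum.inl fun i => Sum.inl (v i) : ℕ ⊕ Fin n → ℕ ⊕ Fin 0) =
        Term.var (Sum.inl a) ∧
      t.realize (Sum.elim hH.toModel fun i => hH.toModel (v i)) = hH.toModel a := by
    intro n v t
    obtain ⟨x, rfl⟩ := term_eq_var t
    rcases x with a | i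
    exacts [⟨a, rfl, rfl⟩, ⟨v i, rfl, rfl⟩]
  induction φ with
  | falsum => exact iff_of_false hH.falsum_notMem id
  | equal t u =>
    obtain ⟨a, ha, ha'⟩ := key v t
    obtain ⟨b, hb, hb'⟩ := key v u
    rw [rename, ha, hb]
    simp only [BoundedFormula.Realize, ha', hb']
    exact hH.toModel_eq_iff.symm
  | @rel n l R ts =>
    choose a ha ha' using fun i => key v (ts i)
    simp only [rename, ha, BoundedFormula.Realize, ha']
    exact hH.rename_mem_iff_of_eq_mem (R.formula Term.var) (v := a)
      fun i => hH.toModel_eq_iff.1 (Function.surjInv_eq hH.toModel_surjective _).symm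
  | imp _ _ ih₁ ih₂ =>
    rw [rename, hH.imp_mem_iff]
    exact imp_congr (ih₁ v) (ih₂ v)
  | all φ ih =>
    rw [rename, hH.all_mem_iff]
    have h : ∀ c : ℕ, (fun i => hH.toModel (Fin.snoc (α := fun _ => ℕ) v c i)) =
        Fin.snoc (α := fun _ => hH.Model) (fun i => hH.toModel (v i)) (hH.toModel c) := by
      intro c
      funext i
      refine Fin.lastCases ?_ (fun i => ?_) i <;> simp
    have h' : ∀ c : ℕ,
        instantiate (rename (liftVar (Sum.elim Sum.inl fun i => Sum.inl (v i))) φ) (Term.var c) =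
          rename (Sum.elim Sum.inl fun i => Sum.inl (Fin.snoc (α := fun _ => ℕ) v c i)) φ := by
      intro c
      rw [instantiate_var, rename_rename]
      congr 1
      funext x
      rcases x with a | i
      · rfl
      · refine Fin.lastCases ?_ (fun i => ?_) i <;> simp [liftVar]
    simp only [h', ih, h]
    exact (hH.toModel_surjective.forall (p := fun y => φ.Realize hH.toModel
      (Fin.snoc (α := fun _ => hH.Model) (fun i => hH.toModel (v i)) y))).symm

theorem relabel_mem_iff_realize (φ : L.Sentence) :
    Formula.relabel (Empty.elim : Empty → ℕ) φ ∈ H ↔ hH.Model ⊨ φ := by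
  have h := hH.mem_iff_realize (Formula.relabel (Empty.elim : Empty → ℕ) φ) Fin.elim0
  have e : (Sum.elim Sum.inl fun i => Sum.inl (Fin.elim0 i) : ℕ ⊕ Fin 0 → ℕ ⊕ Fin 0) = id := by
    funext x
    rcases x with a | i
    · rfl
    · exact i.elim0
  rw [e, rename_id] at h
  rw [h, Sentence.Realize, ← Subsingleton.elim (hH.toModel ∘ Empty.elim) default,
    ← Formula.realize_relabel, Formula.Realize]
  congr! 1

end IsHenkin

/-! ### Completeness -/

theorem provable_of_forall_models [L.IsRelational] [Countable (L.BoundedFormula ℕ 1)]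
    {T : L.Theory} {φ : L.Sentence}
    (h : ∀ (M : Type) [L.Structure M] [Nonempty M], M ⊨ T → M ⊨ φ) : Provable T φ := by
  by_contra hT
  let Γ : Set (L.Formula ℕ) := insert (Formula.relabel (Empty.elim : Empty → ℕ) φ).not
    (Formula.relabel (Empty.elim : Empty → ℕ) '' T)
  have hΓ : Consistent Γ := fun h => hT (.raa h)
  have hfresh : ∀ᶠ c in atTop, ∀ ψ ∈ Γ, IsFresh c ψ := by
    filter_upwards [eventually_isFresh (Formula.relabel (Empty.elim : Empty → ℕ) φ).not] with c hc
    rintro ψ (rfl | ⟨ψ, -, rfl⟩)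
    · exact hc
    · intro d
      rw [formula_relabel_eq_rename, rename_rename]
      congr 1
      funext x
      rcases x with a | i
      · exact a.elim
      · rfl
  obtain ⟨H, hΓH, hH⟩ := exists_isHenkin hΓ hfresh
  have hφ := (hH.relabel_mem_iff_realize φ).2 (h hH.Model ⟨fun ψ hψ => (hH.relabel_mem_iff_realize ψ).1 (hΓH (.inr ⟨ψ, hψ, rfl⟩))⟩)
  exact hH.falsum_notMem (hH.imp_mem_iff.1 (hΓH (.inl rfl)) hφ)

/-! ### Families of sets with equally large cells -/

section Cells

variable {X Y ι : Type} {K K' n : ℕ}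

@[norm_cast]
theorem natCast_min (a b : ℕ) : ((min a b : ℕ) : ℕ∞) = min (a : ℕ∞) b :=
  Nat.mono_cast.map_min

/-- Two sets have the same number of elements, where numbers from `K` on are not distinguished. -/
def SameSize (K : ℕ) (s : Set X) (t : Set Y) : Prop :=
  min s.encard K = min t.encard K

theorem SameSize.symm {s : Set X} {t : Set Y} (h : SameSize K s t) : SameSize K t s :=
  Eq.symm h

theorem SameSize.mono {s : Set X} {t : Set Y} (h : SameSize K s t) (hK : K' ≤ K) :
    SameSize K' s t := by
  have hK' : (K' : ℕ∞) ≤ K := by exact_mod_cast hK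
  have := congrArg (fun x => min x (K' : ℕ∞)) h
  simpa only [min_assoc, min_eq_right hK', SameSize] using this

theorem sameSize_of_infinite {s : Set X} {t : Set Y} (hs : s.Infinite) (ht : t.Infinite) :
    SameSize K s t := by
  rw [SameSize, hs.encard_eq, ht.encard_eq]

theorem SameSize.nonempty {s : Set X} {t : Set Y} (h : SameSize K s t) (hK : 1 ≤ K)
    (hs : s.Nonempty) : t.Nonempty := by
  have h' := h.mono hK
  rw [SameSize, Nat.cast_one, min_eq_right (one_le_encard_iff_nonempty.2 hs)] at h'
  exact one_le_encard_iff_nonempty.1 (min_eq_right_iff.1 h'.symm)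

theorem SameSize.exists_eq_singleton {x : X} {t : Set Y} (h : SameSize K {x} t) (hK : 2 ≤ K) :
    ∃ y, t = {y} := by
  have h' := h.mono hK
  rw [SameSize, encard_singleton] at h'
  refine encard_eq_one.1 ?_
  rcases eq_or_ne t.encard ⊤ with ht | ht
  · rw [ht] at h'
    rw [top_inf_eq] at h'
    norm_cast at h'
  · lift t.encard to ℕ using ht with m
    norm_cast at h' ⊢
    omega

/-- Take m = min(a, K). If a + b < 2K, then a < K, so m = a, g = a + b and b remains. Otherwise b ≥
K, and at least 2K − K = K remains of g. -/
theorem exists_truncated_summand {a b g : ℕ∞} (hab : a ≤ b)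
    (h : min (a + b) ((2 * K : ℕ) : ℕ∞) = min g ((2 * K : ℕ) : ℕ∞)) :
    ∃ m : ℕ, (m : ℕ∞) ≤ g ∧ min a K = min (m : ℕ∞) K ∧
      ∀ r : ℕ∞, r + m = g → min b K = min r K := by
  have key : ∃ m : ℕ, (m : ℕ∞) = min a K := by
    rcases eq_or_ne a ⊤ with rfl | ha
    · exact ⟨K, by simp⟩
    · lift a to ℕ using ha
      exact ⟨min a K, natCast_min a K⟩
  obtain ⟨m, hm⟩ := key
  have hmg : (m : ℕ∞) ≤ g := by
    rw [hm]
    calc min a K ≤ min (a + b) ((2 * K : ℕ) : ℕ∞) :=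
          min_le_min le_self_add (by exact_mod_cast (by omega))
      _ ≤ g := h ▸ min_le_left _ _
  refine ⟨m, hmg, by rw [hm, min_assoc, min_self], fun r hr => ?_⟩
  subst hr
  rcases eq_or_ne r ⊤ with rfl | hr <;> rcases eq_or_ne b ⊤ with rfl | hb
  · rfl
  · lift b to ℕ using hb
    lift a to ℕ using ne_top_of_le_ne_top (ENat.natCast_ne_top b) hab
    rw [top_add, top_inf_eq] at h
    rw [top_inf_eq]
    norm_cast at *
    omega
  · lift r to ℕ using hr
    rw [add_top, top_inf_eq] at h
    rw [top_inf_eq]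
    rcases eq_or_ne a ⊤ with rfl | ha
    · rw [top_inf_eq] at hm
      norm_cast at *
      omega
    · lift a to ℕ using ha
      norm_cast at *
      omega
  · lift r to ℕ using hr
    lift b to ℕ using hb
    lift a to ℕ using ne_top_of_le_ne_top (ENat.natCast_ne_top b) hab
    norm_cast at *
    omega

/-- Only the smaller part of F has to be copied, and a finite copy is enough; so `t` is finite or
cofinite in `G`, which later keeps it inside the field of sets. -/
theorem exists_subset_sameSize {F A : Set X} {G : Set Y} (h : SameSize (2 * K) F G) :
    ∃ t ⊆ G, (t.Finite ∨ (G \ t).Finite) ∧ SameSize K (F ∩ A) t ∧ SameSize K (F \ A) (G \ t) := by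
  have hF : (F ∩ A).encard + (F \ A).encard = F.encard := by
    rw [add_comm, encard_sdiff_add_encard_inter]
  rw [SameSize, ← hF] at h
  rcases le_total (F ∩ A).encard (F \ A).encard with hle | hle
  · obtain ⟨m, hm, h₁, h₂⟩ := exists_truncated_summand hle h
    obtain ⟨t, ht, htm⟩ := exists_subset_encard_eq hm
    refine ⟨t, ht, .inl (finite_of_encard_eq_coe htm), ?_, h₂ _ ?_⟩
    · rw [SameSize, htm, h₁]
    · rw [← htm, encard_sdiff_add_encard_of_subset ht]
  · rw [add_comm] at h
    obtain ⟨m, hm, h₁, h₂⟩ := exists_truncated_summand hle h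
    obtain ⟨t, ht, htm⟩ := exists_subset_encard_eq hm
    have e : G \ (G \ t) = t := sdiff_sdiff_cancel_left ht
    refine ⟨G \ t, sdiff_subset, .inr ?_, h₂ _ ?_, ?_⟩
    · rw [e]
      exact finite_of_encard_eq_coe htm
    · rw [← htm, encard_sdiff_add_encard_of_subset ht]
    · rw [e, SameSize, htm, h₁]

/-- The cell of the partition generated by the sets `A i` on which membership in them is given by
`ε`. -/
def cell (A : ι → Set X) (ε : ι → Prop) : Set X :=
  {x | ∀ i, x ∈ A i ↔ ε i}

theorem mem_cell_self (A : ι → Set X) (x : X) : x ∈ cell A fun i => x ∈ A i :=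
  fun _ => .rfl

theorem eq_of_mem_cell {A : ι → Set X} {ε : ι → Prop} {x : X} (h : x ∈ cell A ε) :
    ε = fun i => x ∈ A i :=
  funext fun i => (propext (h i)).symm

/-- Corresponding cells of two families of sets have the same size up to `K`. -/
def SameCells (K : ℕ) (A : ι → Set X) (B : ι → Set Y) : Prop :=
  ∀ ε, SameSize K (cell A ε) (cell B ε)

namespace SameCells

variable {A : ι → Set X} {B : ι → Set Y}

theorem symm (h : SameCells K A B) : SameCells K B A := fun ε => (h ε).symm

theorem mono (h : SameCells K A B) (hK : K' ≤ K) : SameCells K' A B := fun ε => (h ε).mono hK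

theorem exists_imp (h : SameCells K A B) (hK : 1 ≤ K) (P : (ι → Prop) → Prop)
    (hP : ∃ x, P fun i => x ∈ A i) : ∃ y, P fun i => y ∈ B i := by
  obtain ⟨x, hx⟩ := hP
  obtain ⟨y, hy⟩ := (h _).nonempty hK ⟨x, mem_cell_self A x⟩
  exact ⟨y, by rwa [← eq_of_mem_cell hy]⟩

theorem exists_iff (h : SameCells K A B) (hK : 1 ≤ K) (P : (ι → Prop) → Prop) :
    (∃ x, P fun i => x ∈ A i) ↔ ∃ y, P fun i => y ∈ B i :=
  ⟨h.exists_imp hK P, h.symm.exists_imp hK P⟩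

theorem exists_eq_singleton (h : SameCells K A B) (hK : 2 ≤ K) {i : ι} {x : X} (hi : A i = {x}) :
    ∃ y, B i = {y} := by
  have hcell : cell A (fun j => x ∈ A j) = {x} := by
    refine Subset.antisymm (fun z hz => ?_) (singleton_subset_iff.2 (mem_cell_self A x))
    rw [← hi]
    exact (hz i).2 (by simp [hi])
  have hs := h fun j => x ∈ A j
  rw [hcell] at hs
  obtain ⟨y, hy⟩ := hs.exists_eq_singleton hK
  refine ⟨y, Subset.antisymm (fun z hz => ?_) (singleton_subset_iff.2 ?_)⟩
  -- The pattern of `z` is realized in `X` by a point of `A i`, that is by `x`; hence `z` lies in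
  -- the cell matching that of `x`, which is a singleton.
  · rw [← hy]
    obtain ⟨w, hw, hw'⟩ := h.symm.exists_imp (one_le_two.trans hK)
      (fun ε => ε i ∧ ε = fun j => z ∈ B j) ⟨z, hz, rfl⟩
    rw [hi] at hw
    rw [← mem_singleton_iff.1 hw, hw']
    exact mem_cell_self B z
  · have : y ∈ cell B fun j => x ∈ A j := by rw [hy]; rfl
    exact (this i).2 (by simp [hi])

end SameCells

theorem cell_snoc (A : Fin n → Set X) (A' : Set X) (ε : Fin (n + 1) → Prop) :
    cell (Fin.snoc (α := fun _ => Set X) A A') ε =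
      cell A (fun i => ε i.castSucc) ∩ {x | x ∈ A' ↔ ε (Fin.last n)} := by
  ext x
  simp [cell, Fin.forall_fin_succ']

theorem iUnion_mem_booleanSubalgebra [Finite ι] (𝓑 : BooleanSubalgebra (Set X))
    {A : ι → Set X} (hA : ∀ i, A i ∈ 𝓑) : ⋃ i, A i ∈ 𝓑 := by
  have : Fintype ι := Fintype.ofFinite ι
  rw [← iSup_eq_iUnion, ← Finset.sup_univ_eq_iSup]
  exact Finset.sup_mem (𝓑 : Set (Set X)) 𝓑.bot_mem (fun _ h _ h' => 𝓑.sup_mem h h') _ _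
    fun i _ => hA i

theorem finite_mem_booleanSubalgebra (𝓑 : BooleanSubalgebra (Set X)) (hs : ∀ x, {x} ∈ 𝓑)
    {s : Set X} (hf : s.Finite) : s ∈ 𝓑 := by
  have : Finite s := hf
  rw [← iUnion_of_singleton_coe s]
  exact iUnion_mem_booleanSubalgebra 𝓑 fun x => hs x

theorem cell_mem_booleanSubalgebra [Finite ι] (𝓑 : BooleanSubalgebra (Set X))
    {A : ι → Set X} (hA : ∀ i, A i ∈ 𝓑) (ε : ι → Prop) : cell A ε ∈ 𝓑 := by
  classical
  have h : cell A ε = (⋃ i, if ε i then (A i)ᶜ else A i)ᶜ := by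
    ext x
    simp only [cell, mem_ofPred_eq, compl_iUnion, mem_iInter]
    refine forall_congr' fun i => ?_
    split_ifs with hi <;> simp [hi]
  rw [h]
  refine 𝓑.compl_mem (iUnion_mem_booleanSubalgebra 𝓑 fun i => ?_)
  split_ifs
  exacts [𝓑.compl_mem (hA i), hA i]

/-- Each cell of `B` is split like the corresponding cell of `A` is split by `A'`. The finitely many
pieces are finite or cofinite in cells, so their union belongs to `𝓑`. -/
theorem SameCells.exists_extension {A : Fin n → Set X} {B : Fin n → Set Y}
    (h : SameCells (2 * K) A B) (𝓑 : BooleanSubalgebra (Set Y)) (hs : ∀ y, {y} ∈ 𝓑)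
    (hB : ∀ i, B i ∈ 𝓑) (A' : Set X) :
    ∃ B' ∈ 𝓑, SameCells K (Fin.snoc (α := fun _ => Set X) A A')
      (Fin.snoc (α := fun _ => Set Y) B B') := by
  choose t ht hfin h₁ h₂ using fun ε => exists_subset_sameSize (A := A') (h ε)
  have hcell := cell_mem_booleanSubalgebra 𝓑 hB
  have hmem : ∀ {ε y}, y ∈ cell B ε → (y ∈ ⋃ ε, t ε ↔ y ∈ t ε) := by
    intro ε y hy
    refine ⟨fun hy' => ?_, fun hy' => mem_iUnion_of_mem ε hy'⟩
    obtain ⟨ε', hε'⟩ := mem_iUnion.1 hy'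
    rwa [eq_of_mem_cell hy, ← eq_of_mem_cell (ht ε' hε')]
  refine ⟨⋃ ε, t ε, iUnion_mem_booleanSubalgebra 𝓑 fun ε => ?_, fun ε => ?_⟩
  · rcases hfin ε with hf | hf
    · exact finite_mem_booleanSubalgebra 𝓑 hs hf
    · rw [← sdiff_sdiff_cancel_left (ht ε)]
      exact 𝓑.sdiff_mem (hcell ε) (finite_mem_booleanSubalgebra 𝓑 hs hf)
  · rw [cell_snoc, cell_snoc]
    by_cases hp : ε (Fin.last n)
    · convert h₁ fun i => ε i.castSucc using 1
      · simp only [hp, iff_true, ofPred_mem_eq]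
      · ext y
        simp only [hp, iff_true, ofPred_mem_eq]
        exact ⟨fun hy => (hmem hy.1).1 hy.2, fun hy => ⟨ht _ hy, (hmem (ht _ hy)).2 hy⟩⟩
    · convert h₂ fun i => ε i.castSucc using 1
      · simp only [hp, iff_false]
        rfl
      · ext y
        simp only [hp, iff_false]
        exact ⟨fun hy => ⟨hy.1, fun hy' => hy.2 ((hmem hy.1).2 hy')⟩,
          fun hy => ⟨hy.1, fun hy' => hy.2 ((hmem hy.1).1 hy')⟩⟩

end Cells

/-! ### Models of `BAC` -/

section Models

variable {M : Type} [classLang.Structure M] {n : ℕ}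

/-- Membership in a structure for the language of class theory. -/
def Mem (x y : M) : Prop := Structure.RelMap (L := classLang) ClassRel.mem ![x, y]

/-- Being a set in a structure for the language of class theory. -/
def IsSet (x : M) : Prop := Structure.RelMap (L := classLang) ClassRel.isSet ![x]

@[simp]
theorem realize_memF {v : Empty → M} {xs : Fin n → M} (i j : Fin n) :
    (memF i j).Realize v xs ↔ Mem (xs i) (xs j) :=
  BoundedFormula.realize_rel₂

@[simp]
theorem realize_isSetF {v : Empty → M} {xs : Fin n → M} (i : Fin n) :
    (isSetF i).Realize v xs ↔ IsSet (xs i) :=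
  BoundedFormula.realize_rel₁

@[simp]
theorem realize_eqF {v : Empty → M} {xs : Fin n → M} (i j : Fin n) :
    (eqF i j).Realize v xs ↔ xs i = xs j :=
  BoundedFormula.realize_bdEqual _ _

@[simp]
theorem realize_allSet {v : Empty → M} {xs : Fin n → M}
    {φ : classLang.BoundedFormula Empty (n + 1)} :
    (allSet φ).Realize v xs ↔
      ∀ x : M, IsSet x → φ.Realize v (Fin.snoc (α := fun _ => M) xs x) := by
  simp [allSet]

@[simp]
theorem realize_exSet {v : Empty → M} {xs : Fin n → M}
    {φ : classLang.BoundedFormula Empty (n + 1)} :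
    (exSet φ).Realize v xs ↔
      ∃ x : M, IsSet x ∧ φ.Realize v (Fin.snoc (α := fun _ => M) xs x) := by
  simp [exSet]

theorem isSet_of_mem (hM : M ⊨ BAC) {x y : M} (h : Mem x y) : IsSet x := by
  have := hM.realize_of_mem axMem (by simp [BAC, CAS])
  simp [axMem, Sentence.Realize, Formula.Realize, Fin.snoc] at this
  exact this x y h

theorem exists_empty (hM : M ⊨ BAC) : ∃ x : M, IsSet x ∧ ∀ y, IsSet y → ¬ Mem y x := by
  have := hM.realize_of_mem axEmp (by simp [BAC, CAS])
  simpa [axEmp, Sentence.Realize, Formula.Realize, Fin.snoc] using this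

theorem exists_adjoin (hM : M ⊨ BAC) {x y : M} (hx : IsSet x) (hy : IsSet y) :
    ∃ z : M, IsSet z ∧ ∀ u, IsSet u → (Mem u z ↔ Mem u x ∨ u = y) := by
  have := hM.realize_of_mem axAdj (by simp [BAC, CAS])
  simp [axAdj, Sentence.Realize, Formula.Realize, Fin.snoc] at this
  exact this x hx y hy

theorem eq_iff_forall_mem_iff (hM : M ⊨ BAC) (X Y : M) :
    X = Y ↔ ∀ x, IsSet x → (Mem x X ↔ Mem x Y) := by
  have := hM.realize_of_mem axCExt (by simp [BAC])
  simp [axCExt, Sentence.Realize, Formula.Realize, Fin.snoc] at this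
  exact this X Y

theorem exists_set_union (hM : M ⊨ BAC) {x y : M} (hx : IsSet x) (hy : IsSet y) :
    ∃ z : M, IsSet z ∧ ∀ u, IsSet u → (Mem u z ↔ Mem u x ∨ Mem u y) := by
  have := hM.realize_of_mem axUnion (by simp [BAC])
  simp [axUnion, Sentence.Realize, Formula.Realize, Fin.snoc] at this
  exact this x hx y hy

theorem exists_notMem (hM : M ⊨ BAC) {x : M} (hx : IsSet x) : ∃ y : M, IsSet y ∧ ¬ Mem y x := by
  have := hM.realize_of_mem axUB (by simp [BAC])
  simp [axUB, Sentence.Realize, Formula.Realize, Fin.snoc] at this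
  exact this x hx

theorem exists_union (hM : M ⊨ BAC) (X Y : M) :
    ∃ Z : M, ∀ x, IsSet x → (Mem x Z ↔ Mem x X ∨ Mem x Y) := by
  have := hM.realize_of_mem axCUnion (by simp [BAC])
  simp [axCUnion, Sentence.Realize, Formula.Realize, Fin.snoc] at this
  exact this X Y

theorem exists_inter (hM : M ⊨ BAC) (X Y : M) :
    ∃ Z : M, ∀ x, IsSet x → (Mem x Z ↔ Mem x X ∧ Mem x Y) := by
  have := hM.realize_of_mem axCIntersection (by simp [BAC])
  simp [axCIntersection, Sentence.Realize, Formula.Realize, Fin.snoc] at this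
  exact this X Y

theorem exists_compl (hM : M ⊨ BAC) (X : M) :
    ∃ Y : M, ∀ x, IsSet x → (Mem x Y ↔ ¬ Mem x X) := by
  have := hM.realize_of_mem axCComp (by simp [BAC])
  simp [axCComp, Sentence.Realize, Formula.Realize, Fin.snoc] at this
  exact this X

/-- The sets that belong to a class. -/
def extension (X : M) : Set {x : M // IsSet x} := {x | Mem x.1 X}

theorem extension_injective (hM : M ⊨ BAC) : Function.Injective (extension (M := M)) :=
  fun X Y h => (eq_iff_forall_mem_iff hM X Y).2 fun x hx => Set.ext_iff.1 h ⟨x, hx⟩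

/-- The extensions of classes in a model of `BAC` form a field of sets. -/
def extensions (hM : M ⊨ BAC) : BooleanSubalgebra (Set {x : M // IsSet x}) where
  carrier := range extension
  supClosed' := by
    rintro _ ⟨X, rfl⟩ _ ⟨Y, rfl⟩
    obtain ⟨Z, hZ⟩ := exists_union hM X Y
    exact ⟨Z, Set.ext fun x => hZ x.1 x.2⟩
  infClosed' := by
    rintro _ ⟨X, rfl⟩ _ ⟨Y, rfl⟩
    obtain ⟨Z, hZ⟩ := exists_inter hM X Y
    exact ⟨Z, Set.ext fun x => hZ x.1 x.2⟩
  compl_mem' := by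
    rintro _ ⟨X, rfl⟩
    obtain ⟨Y, hY⟩ := exists_compl hM X
    exact ⟨Y, Set.ext fun x => hY x.1 x.2⟩
  bot_mem' := by
    obtain ⟨x, -, hx⟩ := exists_empty hM
    exact ⟨x, eq_empty_of_forall_notMem fun y => hx y.1 y.2⟩

theorem mem_extensions (hM : M ⊨ BAC) {s : Set {x : M // IsSet x}} :
    s ∈ extensions hM ↔ ∃ X, extension X = s := .rfl

theorem exists_isSet_extension_eq_of_finite (hM : M ⊨ BAC) {s : Set {x : M // IsSet x}}
    (hs : s.Finite) : ∃ X : M, IsSet X ∧ extension X = s := by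
  induction s, hs using Set.Finite.induction_on with
  | empty =>
    obtain ⟨x, hx, h⟩ := exists_empty hM
    exact ⟨x, hx, eq_empty_of_forall_notMem fun y => h y.1 y.2⟩
  | @insert a s _ _ ih =>
    obtain ⟨x, hx, rfl⟩ := ih
    obtain ⟨z, hz, h⟩ := exists_adjoin hM hx a.2
    refine ⟨z, hz, Set.ext fun u => (h u.1 u.2).trans ?_⟩
    rw [mem_insert_iff, or_comm, Subtype.ext_iff]
    rfl

theorem singleton_mem_extensions (hM : M ⊨ BAC) (x : {x : M // IsSet x}) : {x} ∈ extensions hM :=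
  let ⟨X, _, hX⟩ := exists_isSet_extension_eq_of_finite hM (finite_singleton x)
  ⟨X, hX⟩

theorem extension_ne_univ (hM : M ⊨ BAC) {X : M} (hX : IsSet X) : extension X ≠ univ := by
  obtain ⟨y, hy, h⟩ := exists_notMem hM hX
  exact fun e => h (eq_univ_iff_forall.1 e ⟨y, hy⟩)

theorem infinite_isSet (hM : M ⊨ BAC) : Infinite {x : M // IsSet x} := by
  by_contra h
  have := not_infinite_iff_finite.1 h
  obtain ⟨X, hX, e⟩ := exists_isSet_extension_eq_of_finite hM (finite_univ (α := {x : M // IsSet x}))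
  exact extension_ne_univ hM hX e

/-- Complements of singletons are proper: the union of such a set with its singleton would be a
universal set. -/
theorem infinite_setOf_not_isSet (hM : M ⊨ BAC) : {X : M | ¬ IsSet X}.Infinite := by
  have := infinite_isSet hM
  choose X hX hXe using fun x : {x : M // IsSet x} =>
    exists_isSet_extension_eq_of_finite hM (finite_singleton x)
  choose Y hY using fun x => exists_compl hM (X x)
  have hYe : ∀ x, extension (Y x) = {x}ᶜ := by
    intro x
    rw [← hXe]
    exact Set.ext fun u => hY x u.1 u.2
  refine infinite_of_injective_forall_mem (f := Y) (fun x y h => ?_) fun x hx => ?_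
  · have := congrArg extension h
    rw [hYe, hYe, compl_inj_iff] at this
    exact singleton_injective this
  · obtain ⟨z, hz, h⟩ := exists_set_union hM (hX x) hx
    refine extension_ne_univ hM hz (eq_univ_of_forall fun u => (h u.1 u.2).2 ?_)
    rw [hY x u.1 u.2]
    exact em _

end Models

/-! ### The back-and-forth argument -/

section Game

variable {M N : Type} [classLang.Structure M] [classLang.Structure N] {K K' n : ℕ}

/-- The set of sets that represents an object in the role of a variable of type `τ`: its extension
for type `1`, and the singleton of the object, if that is a set, for type `0`. -/
def extent (τ : ℕ) (a : M) : Set {x : M // IsSet x} :=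
  if τ = 1 then extension a else {x | x.1 = a}

theorem extent_zero (a : M) : extent 0 a = {x | x.1 = a} := if_neg zero_ne_one

theorem extent_one (a : M) : extent 1 a = extension a := if_pos rfl

theorem extent_zero_of_isSet {a : M} (ha : IsSet a) : extent 0 a = {⟨a, ha⟩} := by
  rw [extent_zero]
  ext x
  exact (Subtype.ext_iff (a2 := ⟨a, ha⟩)).symm

theorem extent_zero_of_not_isSet {a : M} (ha : ¬ IsSet a) : extent 0 a = ∅ := by
  rw [extent_zero]
  exact eq_empty_of_forall_notMem fun x hx => ha (hx ▸ x.2)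

theorem isSet_iff_exists_mem_extent_zero (a : M) : IsSet a ↔ ∃ x, x ∈ extent 0 a :=
  ⟨fun h => ⟨⟨a, h⟩, by rw [extent_zero]; rfl⟩, fun ⟨x, hx⟩ => by
    rw [extent_zero] at hx; exact hx ▸ x.2⟩

theorem eq_iff_exists_mem_extent_zero {a b : M} (hb : IsSet b) :
    a = b ↔ ∃ x, x ∈ extent 0 a ∧ x ∈ extent 0 b := by
  rw [extent_zero, extent_zero]
  exact ⟨fun h => ⟨⟨b, hb⟩, h.symm, rfl⟩, fun ⟨x, h, h'⟩ => h.symm.trans h'⟩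

theorem mem_iff_exists_mem_extent (hM : M ⊨ BAC) {a b : M} :
    Mem a b ↔ ∃ x, x ∈ extent 0 a ∧ x ∈ extent 1 b := by
  rw [extent_zero, extent_one]
  exact ⟨fun h => ⟨⟨a, isSet_of_mem hM h⟩, rfl, h⟩, fun ⟨x, h, h'⟩ => h ▸ h'⟩

theorem ne_iff_exists_mem_extent_one (hM : M ⊨ BAC) {a b : M} :
    a ≠ b ↔ ∃ x, ¬ (x ∈ extent 1 a ↔ x ∈ extent 1 b) := by
  rw [← (extension_injective hM).ne_iff, extent_one, extent_one, Ne, Set.ext_iff, not_forall]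

theorem extent_mem_extensions (hM : M ⊨ BAC) {τ : ℕ} (hτ : τ < 2) (a : M) :
    extent τ a ∈ extensions hM := by
  interval_cases τ
  · by_cases ha : IsSet a
    · rw [extent_zero_of_isSet ha]
      exact singleton_mem_extensions hM _
    · rw [extent_zero_of_not_isSet ha]
      exact (extensions hM).bot_mem
  · rw [extent_one]
    exact ⟨a, rfl⟩

/-- The tuples `a` and `b`, whose entries have the types given by `s`, cannot be told apart by
counting elements up to `K`. -/
structure Similar (K : ℕ) (s : Fin n → ℕ) (a : Fin n → M) (b : Fin n → N) : Prop where
  sameCells : SameCells K (fun i => extent (s i) (a i)) fun i => extent (s i) (b i)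
  -- The cells do not give this, since all proper classes have the same empty extent in type 0.
  eq_iff : ∀ i j, s i = 0 → s j = 0 → (a i = a j ↔ b i = b j)

theorem extent_snoc (s : Fin n → ℕ) (a : Fin n → M) (τ : ℕ) (c : M) :
    (fun i => extent (Fin.snoc (α := fun _ => ℕ) s τ i) (Fin.snoc (α := fun _ => M) a c i)) =
      Fin.snoc (α := fun _ => Set {x : M // IsSet x}) (fun i => extent (s i) (a i))
        (extent τ c) := by
  funext i
  refine Fin.lastCases ?_ (fun i => ?_) i <;> simp

namespace Similar

variable {s : Fin n → ℕ} {a : Fin n → M} {b : Fin n → N}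

theorem symm (h : Similar K s a b) : Similar K s b a :=
  ⟨h.sameCells.symm, fun i j hi hj => (h.eq_iff i j hi hj).symm⟩

theorem mono (h : Similar K s a b) (hK : K' ≤ K) : Similar K' s a b :=
  ⟨h.sameCells.mono hK, h.eq_iff⟩

theorem isSet_iff (h : Similar K s a b) (hK : 1 ≤ K) {i : Fin n} (hi : s i = 0) :
    IsSet (a i) ↔ IsSet (b i) := by
  rw [isSet_iff_exists_mem_extent_zero, isSet_iff_exists_mem_extent_zero, ← hi]
  exact h.sameCells.exists_iff hK fun ε => ε i

theorem mem_iff (h : Similar K s a b) (hK : 1 ≤ K) (hM : M ⊨ BAC) (hN : N ⊨ BAC) {i j : Fin n}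
    (hi : s i = 0) (hj : s j = 1) : Mem (a i) (a j) ↔ Mem (b i) (b j) := by
  rw [mem_iff_exists_mem_extent hM, mem_iff_exists_mem_extent hN, ← hi, ← hj]
  exact h.sameCells.exists_iff hK fun ε => ε i ∧ ε j

theorem eq_iff_of_one (h : Similar K s a b) (hK : 1 ≤ K) (hM : M ⊨ BAC) (hN : N ⊨ BAC)
    {i j : Fin n} (hi : s i = 1) (hj : s j = 1) : a i = a j ↔ b i = b j := by
  rw [← not_iff_not, ← Ne, ← Ne, ne_iff_exists_mem_extent_one hM, ne_iff_exists_mem_extent_one hN]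
  have := h.sameCells.exists_iff hK fun ε => ¬ (ε i ↔ ε j)
  simpa only [hi, hj] using this

theorem snoc {τ : ℕ} {c : M} {d : N} (h : Similar K' s a b)
    (hc : SameCells K
      (Fin.snoc (α := fun _ => Set {x : M // IsSet x}) (fun i => extent (s i) (a i)) (extent τ c))
      (Fin.snoc (α := fun _ => Set {x : N // IsSet x}) (fun i => extent (s i) (b i))
        (extent τ d)))
    (he : τ = 0 → ∀ i, s i = 0 → (a i = c ↔ b i = d)) :
    Similar K (Fin.snoc (α := fun _ => ℕ) s τ) (Fin.snoc (α := fun _ => M) a c)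
      (Fin.snoc (α := fun _ => N) b d) := by
  refine ⟨by rwa [extent_snoc, extent_snoc], fun i j => ?_⟩
  refine Fin.lastCases ?_ (fun i => ?_) i <;> refine Fin.lastCases ?_ (fun j => ?_) j
  · simp
  · simpa [eq_comm] using fun hτ hj => he hτ j hj
  · simpa using fun hi hτ => he hτ i hi
  · simpa using h.eq_iff i j

theorem exists_snoc (h : Similar (2 * K) s a b) (hK : 2 ≤ K) (hN : N ⊨ BAC)
    (hs : ∀ i, s i < 2) {τ : ℕ} (hτ : τ < 2) (c : M) :
    ∃ d : N, Similar K (Fin.snoc (α := fun _ => ℕ) s τ) (Fin.snoc (α := fun _ => M) a c)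
      (Fin.snoc (α := fun _ => N) b d) := by
  have hK₁ : 1 ≤ K := one_le_two.trans hK
  obtain ⟨B', hB', hc⟩ := h.sameCells.exists_extension (extensions hN)
    (singleton_mem_extensions hN) (fun i => extent_mem_extensions hN (hs i) (b i)) (extent τ c)
  interval_cases τ
  · by_cases hset : IsSet c
    · obtain ⟨⟨d, hd⟩, hd'⟩ := hc.exists_eq_singleton hK (i := Fin.last n) (x := ⟨c, hset⟩)
        (by rw [Fin.snoc_last, extent_zero_of_isSet])
      rw [Fin.snoc_last, ← extent_zero_of_isSet] at hd'
      subst hd'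
      refine ⟨d, h.snoc hc fun _ i hi => ?_⟩
      rw [eq_iff_exists_mem_extent_zero hset, eq_iff_exists_mem_extent_zero hd]
      simpa [hi] using hc.exists_iff hK₁ fun ε => ε i.castSucc ∧ ε (Fin.last n)
    · have hempty : B' = ∅ := by
        have := hc.exists_iff hK₁ fun ε => ε (Fin.last n)
        simp only [Fin.snoc_last, extent_zero_of_not_isSet hset] at this
        exact eq_empty_of_forall_notMem fun y hy => (this.2 ⟨y, hy⟩).elim fun _ hx => hx
      have hd : ∃ d : N, ¬ IsSet d ∧ ∀ i, s i = 0 → (a i = c ↔ b i = d) := by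
        -- A proper class already played at type 0 is answered by its partner; a new one by a proper
        -- class not among the entries of `b`.
        by_cases hi : ∃ i, s i = 0 ∧ a i = c
        · obtain ⟨i, hi, rfl⟩ := hi
          exact ⟨b i, by rwa [← h.isSet_iff (by omega) hi], fun j hj => h.eq_iff j i hj hi⟩
        · obtain ⟨d, hd, hd'⟩ := (infinite_setOf_not_isSet hN).exists_notMem_finite
            (finite_range b)
          exact ⟨d, hd, fun i hi' => iff_of_false (fun e => hi ⟨i, hi', e⟩)
            fun e => hd' ⟨i, e⟩⟩
      obtain ⟨d, hd, hd'⟩ := hd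
      rw [hempty, ← extent_zero_of_not_isSet hd] at hc
      exact ⟨d, h.snoc hc fun _ => hd'⟩
  · obtain ⟨d, rfl⟩ := (mem_extensions hN).1 hB'
    rw [← extent_one d] at hc
    exact ⟨d, h.snoc hc fun h => absurd h one_ne_zero⟩

end Similar

theorem similar_elim0 (hM : M ⊨ BAC) (hN : N ⊨ BAC) (s : Fin 0 → ℕ) (a : Fin 0 → M)
    (b : Fin 0 → N) : Similar K s a b := by
  have := infinite_isSet hM
  have := infinite_isSet hN
  refine ⟨fun ε => ?_, fun i => i.elim0⟩
  have hu : ∀ {X : Type} (A : Fin 0 → Set X), cell A ε = univ := fun A =>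
    eq_univ_of_forall fun x i => i.elim0
  rw [hu, hu]
  exact sameSize_of_infinite infinite_univ infinite_univ

theorem exists_forall_similar_realize_iff (hM : M ⊨ BAC) (hN : N ⊨ BAC)
    (φ : setLang.BoundedFormula Empty n) (s : Fin n → ℕ) (hs : ∀ i, s i < 2)
    (σ : BoundVar φ → Fin 2)
    (hσ : IsStratification φ (Sum.elim Empty.elim s) fun v => (σ v : ℕ)) :
    ∃ K, 2 ≤ K ∧ ∀ (a : Fin n → M) (b : Fin n → N), Similar K s a b →
      ((setToClass.onBoundedFormula φ).Realize default a ↔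
        (setToClass.onBoundedFormula φ).Realize default b) := by
  have hvar : ∀ {n : ℕ} (t : setLang.Term (Empty ⊕ Fin n)), ∃ i, t = Term.var (Sum.inr i) := by
    intro n t
    rcases t with (e | i) | ⟨f, _⟩
    exacts [e.elim, ⟨i, rfl⟩, f.elim]
  induction φ with
  | falsum => exact ⟨2, le_rfl, fun a b _ => .rfl⟩
  | equal t u =>
    obtain ⟨i, rfl⟩ := hvar t
    obtain ⟨j, rfl⟩ := hvar u
    have hij : s j = s i := hσ
    refine ⟨2, le_rfl, fun a b h => ?_⟩
    change a i = a j ↔ b i = b j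
    have := hs i
    rcases (by omega : s i = 0 ∨ s i = 1) with hi | hi
    · exact h.eq_iff i j hi (hij.trans hi)
    · exact h.eq_iff_of_one one_le_two hM hN hi (hij.trans hi)
  | rel R ts =>
    cases R
    obtain ⟨i, hi⟩ := hvar (ts 0)
    obtain ⟨j, hj⟩ := hvar (ts 1)
    have hij : s j = s i + 1 := by
      have : Sum.elim Empty.elim s (termVar (ts 1)) =
        Sum.elim Empty.elim s (termVar (ts 0)) + 1 := hσ
      rwa [hi, hj] at this
    have hrel : ∀ {M : Type} [classLang.Structure M] (a : Fin _ → M),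
        (setToClass.onBoundedFormula (.rel SetRel.mem ts)).Realize default a ↔
          Mem (a i) (a j) := by
      intro M _ a
      rw [LHom.onBoundedFormula, BoundedFormula.realize_rel, Mem]
      refine iff_of_eq (congrArg _ (funext fun k => ?_))
      fin_cases k
      · simp [hi]
      · simp [hj]
    refine ⟨2, le_rfl, fun a b h => ?_⟩
    rw [hrel, hrel]
    have := hs j
    exact h.mem_iff one_le_two hM hN (by omega) (by omega)
  | imp φ ψ ih₁ ih₂ =>
    obtain ⟨K₁, hK₁, h₁⟩ := ih₁ s hs (fun v => σ (Sum.inl v)) hσ.1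
    obtain ⟨K₂, hK₂, h₂⟩ := ih₂ s hs (fun v => σ (Sum.inr v)) hσ.2
    exact ⟨max K₁ K₂, le_max_of_le_left hK₁, fun a b h =>
      imp_congr (h₁ a b (h.mono (le_max_left _ _))) (h₂ a b (h.mono (le_max_right _ _)))⟩
  | @all n φ ih =>
    have hσ' : IsStratification φ
        (Sum.elim Empty.elim (Fin.snoc (α := fun _ => ℕ) s (σ none))) fun v => (σ (some v) : ℕ) := by
      have e : (Sum.elim Empty.elim (Fin.snoc (α := fun _ => ℕ) s (σ none)) : Empty ⊕ Fin _ → ℕ) =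
          Sum.elim (fun x => Sum.elim Empty.elim s (Sum.inl x))
            (Fin.snoc (α := fun _ => ℕ)
              (fun i => Sum.elim (Empty.elim : Empty → ℕ) s (Sum.inr i)) (σ none)) := by
        funext x
        rcases x with x | i
        exacts [x.elim, rfl]
      rw [e]
      exact hσ
    obtain ⟨K, hK, h⟩ := ih _ (fun i => by
      refine Fin.lastCases ?_ (fun i => ?_) i
      · rw [Fin.snoc_last]
        exact (σ none).2
      · simpa using hs i) (fun v => σ (some v)) hσ'
    -- One more move halves the precision; a bound of at least 2 must survive it, so that singletons
    -- are answered by singletons.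
    refine ⟨2 * K, by omega, fun a b hab => ?_⟩
    rw [LHom.onBoundedFormula, BoundedFormula.realize_all, BoundedFormula.realize_all]
    constructor
    · intro H d
      obtain ⟨c, hc⟩ := hab.symm.exists_snoc hK hM hs (σ none).2 d
      exact (h _ _ hc.symm).1 (H c)
    · intro H c
      obtain ⟨d, hd⟩ := hab.exists_snoc hK hN hs (σ none).2 c
      exact (h _ _ hd).2 (H d)

theorem realize_onSentence_iff (hM : M ⊨ BAC) (hN : N ⊨ BAC) {φ : setLang.Sentence}
    (hφ : IsStratifiedSentence 2 φ) :
    M ⊨ setToClass.onSentence φ ↔ N ⊨ setToClass.onSentence φ := by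
  obtain ⟨σ, hσ⟩ := hφ
  obtain ⟨K, -, h⟩ :=
    exists_forall_similar_realize_iff hM hN φ Fin.elim0 (fun i => i.elim0) σ hσ
  exact h default default (similar_elim0 hM hN _ _ _)

end Game

instance : classLang.IsRelational := fun _ => inferInstanceAs (IsEmpty Empty)

instance : Countable classLang.Symbols := by
  have : Countable (Σ l, ClassRel l) :=
    -- The two relation symbols are distinguished by their arities.
    (show Function.Injective fun r : Σ l, ClassRel l => r.1 by
      rintro ⟨_, _ | _⟩ ⟨_, _ | _⟩ h <;> first | rfl | cases h).countable
  exact inferInstanceAs (Countable ((Σ _ : ℕ, Empty) ⊕ Σ l, ClassRel l))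

instance (n : ℕ) : Countable (classLang.BoundedFormula ℕ n) :=
  (sigma_mk_injective (β := fun n => classLang.BoundedFormula ℕ n) (i := n)).countable

end BAClass

theorem mainTheorem9 (φ : BAClass.setLang.Sentence) (hφ : BAClass.IsStratifiedSentence 2 φ) :
    BAClass.Provable BAClass.BAC (BAClass.setToClass.onSentence φ) ∨
      BAClass.Provable BAClass.BAC (BAClass.setToClass.onSentence φ).not := by
  by_cases h : ∃ (M : Type) (_ : BAClass.classLang.Structure M),
      M ⊨ BAClass.BAC ∧ M ⊨ BAClass.setToClass.onSentence φ
  · obtain ⟨M, _, hM, hMφ⟩ := h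
    exact .inl (BAClass.provable_of_forall_models fun N _ _ hN =>
      (BAClass.realize_onSentence_iff hM hN hφ).1 hMφ)
  · exact .inr (BAClass.provable_of_forall_models fun N inst _ hN hNφ => h ⟨N, inst, hN, hNφ⟩)
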